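/- A Dyck word of semilength $n$ is a word of length $2n$ consisting of $n$ letters $x$ and $n$ letters $y$ such that every initial segment contains at least as many $x$'s as $y$'s. Let $\mathcal{D}_n$ be the set of Dyck words of semilength $n$. For $D\in\mathcal{D}_n$ and $1\le i\le n-1$, let $r_i(D)$ be the number of $y$'s between the $i$-th $x$ and the $(i+1)$-st $x$ in $D$, and let $s_i(D)$ be the number of $x$'s between the $i$-th $y$ and the $(i+1)$-st $y$ in $D$. Then for all $n\ge 1$, $$\sum_{D\in\mathcal{D}_n}\ \prod_{i=1}^{n-1}\binom{r_i(D)+s_i(D)}{r_i(D)}=\frac{1}{2n+1}\binom{3n}{n}.$$ -/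

import Mathlib

/-- The letter at (0-based) position `p` of the word `w` is the `i`-th occurrence (`i = 1, 2, …`)
of the letter `a` in `w`. -/
def IsNthOccurrence (w : List DyckStep) (a : DyckStep) (i p : ℕ) : Prop :=
  w[p]? = some a ∧ (w.take p).count a + 1 = i

instance instDecidableIsNthOccurrence (w : List DyckStep) (a : DyckStep) (i p : ℕ) :
    Decidable (IsNthOccurrence w a i p) :=
  inferInstanceAs (Decidable (_ ∧ _))

/-- The number of letters `b` of the word `w` that lie strictly between the `i`-th and the
`(i + 1)`-st occurrence of the letter `a`. -/
def countBetween (w : List DyckStep) (a b : DyckStep) (i : ℕ) : ℕ :=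
  ((Finset.range w.length).filter fun j =>
    w[j]? = some b ∧
      (∃ p < j, IsNthOccurrence w a i p) ∧
      (∃ q < w.length, j < q ∧ IsNthOccurrence w a (i + 1) q)).card

/-- `r_i(D)`: the number of down steps between the `i`-th and the `(i + 1)`-st up step. -/
def DyckWord.rStat (D : DyckWord) (i : ℕ) : ℕ :=
  countBetween D.toList DyckStep.U DyckStep.D i

/-- `s_i(D)`: the number of up steps between the `i`-th and the `(i + 1)`-st down step. -/
def DyckWord.sStat (D : DyckWord) (i : ℕ) : ℕ :=
  countBetween D.toList DyckStep.D DyckStep.U i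

/-!
Write a word to the tail of a queue and read it from the head, the admissible moves being: write
`U`; read `D`; read `U` and write `D` at once. Between the `i`-th and the `(i + 1)`-st double move,
`r_i` letters `D` are read and `s_i` letters `U` are written, in any order, so a Dyck word passes
through the queue in `∏ (r_i + s_i).choose r_i` ways: the Dyck condition says precisely that no
letter has to be read before it is written.

Now let the word vary. The head of the queue decides how it can be read, so a run is a sequence of
pushes of `U` and of pops, where popping `U` appends `D`. The weight `2 * #U + #D` of the queue
grows by `2` at a push, drops by `1` at a pop and vanishes only for the empty queue. Hence the runs
with `n` pushes are the nonnegative sequences of steps `+2` and `-1` from `0` to `0`, and there are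
`(3 * n).choose n / (2 * n + 1)` of them.
-/

/-- The number of sequences of `k` steps `+m` and `p + m * k` steps `-1` which lead from `p` to `0`
without becoming negative. -/
def ballotCount (m : ℕ) : ℕ → ℕ → ℕ
  | 0, 0 => 1
  | p + 1, 0 => ballotCount m p 0
  | 0, k + 1 => ballotCount m m k
  | p + 1, k + 1 => ballotCount m (p + 1 + m) k + ballotCount m p (k + 1)
termination_by p k => (k, p)

theorem succ_mul_choose_mul_succ (m k : ℕ) :
    (m + 1) * (m * (k + 1) + k).choose (m * (k + 1)) =
      (m * (k + 1) + k + 1).choose (m * (k + 1)) := by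
  have h := Nat.choose_mul_succ_eq (m * (k + 1) + k) (m * (k + 1))
  rw [show m * (k + 1) + k + 1 - m * (k + 1) = k + 1 by omega] at h
  apply Nat.eq_of_mul_eq_mul_right (Nat.add_one_pos k)
  linear_combination h

theorem ballotCount_add_mul_choose (m p k : ℕ) :
    ballotCount m p k + m * (p + m * k + k).choose (p + m * k + 1) =
      (p + m * k + k).choose (p + m * k) := by
  fun_induction ballotCount m p k with
  | case1 => simp
  | case2 p ih => simpa using ih
  | case3 k ih =>
    rw [show m + m * k = m * (k + 1) by ring] at ih
    have hchoose := succ_mul_choose_mul_succ m k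
    rw [zero_add, Nat.succ_eq_add_one, ← add_assoc, Nat.choose_succ_succ', ← hchoose]
    linear_combination ih
  | case4 p k ih_up ih_down =>
    rw [show p + 1 + m + m * k = p + m * (k + 1) + 1 by ring,
      add_right_comm (p + m * (k + 1)) 1 k] at ih_up
    rw [Nat.succ_eq_add_one, Nat.succ_eq_add_one, add_right_comm p 1 (m * (k + 1)),
      add_right_comm (p + m * (k + 1)) 1 (k + 1), Nat.choose_succ_succ',
      Nat.choose_succ_succ' _ (p + m * (k + 1))]
    linear_combination ih_up + ih_down

theorem mul_add_one_mul_ballotCount_zero (m n : ℕ) :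
    (m * n + 1) * ballotCount m 0 n = ((m + 1) * n).choose n := by
  have hballot := ballotCount_add_mul_choose m 0 n
  have hchoose := Nat.choose_succ_right_eq (m * n + n) (m * n)
  rw [Nat.add_sub_cancel_left] at hchoose
  rw [zero_add] at hballot
  rw [add_one_mul m n, ← Nat.choose_symm_add]
  linear_combination (m * n + 1) * hballot - m * hchoose

/-- The words with `k` letters `U` and `j` letters `D`. -/
def wordsWithCounts : ℕ → ℕ → Finset (List DyckStep)
  | 0, 0 => {[]}
  | k + 1, 0 => (wordsWithCounts k 0).image (.cons .U)
  | 0, j + 1 => (wordsWithCounts 0 j).image (.cons .D)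
  | k + 1, j + 1 =>
    (wordsWithCounts k (j + 1)).image (.cons .U) ∪ (wordsWithCounts (k + 1) j).image (.cons .D)

theorem mem_wordsWithCounts {k j : ℕ} {l : List DyckStep} :
    l ∈ wordsWithCounts k j ↔ l.count .U = k ∧ l.count .D = j := by
  induction l generalizing k j with
  | nil => rcases k with _ | k <;> rcases j with _ | j <;> simp [wordsWithCounts]
  | cons c l ih =>
    rcases k with _ | k <;> rcases j with _ | j <;> cases c <;> simp [wordsWithCounts, ih]

section SumWords

variable {M : Type*} [AddCommMonoid M] (f : List DyckStep → M) (k j : ℕ)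

theorem sum_wordsWithCounts_zero_succ :
    ∑ t ∈ wordsWithCounts 0 (j + 1), f t = ∑ t ∈ wordsWithCounts 0 j, f (.D :: t) := by
  rw [wordsWithCounts, Finset.sum_image List.cons_injective.injOn]

theorem sum_wordsWithCounts_succ_succ :
    ∑ t ∈ wordsWithCounts (k + 1) (j + 1), f t =
      ∑ t ∈ wordsWithCounts k (j + 1), f (.U :: t) +
        ∑ t ∈ wordsWithCounts (k + 1) j, f (.D :: t) := by
  rw [wordsWithCounts, Finset.sum_union, Finset.sum_image List.cons_injective.injOn,
    Finset.sum_image List.cons_injective.injOn]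
  simp [Finset.disjoint_left]

end SumWords

/-- The number of ways to run a queue which currently holds the word `v` so that it becomes empty
after the word `t` has been written to it. The admissible moves are: write `U`; read `D`; read `U`
and write `D`. -/
def queueRuns : List DyckStep → List DyckStep → ℕ
  | [], [] => 1
  | [], .D :: _ => 0
  | [], .U :: t => queueRuns [.U] t
  | .U :: _, [] => 0
  | .U :: v, .U :: t => queueRuns (.U :: v ++ [.U]) t
  | .U :: v, .D :: t => queueRuns (v ++ [.D]) t
  | .D :: v, [] => queueRuns v []
  | .D :: v, .U :: t => queueRuns (.D :: v ++ [.U]) t + queueRuns v (.U :: t)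
  | .D :: v, .D :: t => queueRuns v (.D :: t)
termination_by v t => v.length + 2 * t.length
decreasing_by all_goals simp <;> omega

/-- The number of runs of a queue holding `v` that empty it after `k` further letters `U` have been
written. Each `U` read entails one `D` written, hence the `k + v.count .U` letters `D`. -/
def queueRunsTotal (v : List DyckStep) (k : ℕ) : ℕ :=
  ∑ t ∈ wordsWithCounts k (k + v.count .U), queueRuns v t

/-- The queue after its head has been read, in a double move if the head is `U`. The empty queue is
left alone. -/
def popQueue : List DyckStep → List DyckStep
  | [] => []
  | .U :: v => v ++ [.D]
  | .D :: v => v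

/-- The potential that every push of `U` increases by `2` and every pop decreases by `1`. -/
def queueWeight (v : List DyckStep) : ℕ := 2 * v.count .U + v.count .D

theorem queueWeight_append_U (v : List DyckStep) : queueWeight (v ++ [.U]) = queueWeight v + 2 := by
  simp +arith [queueWeight]

theorem queueWeight_popQueue {v : List DyckStep} (hv : v ≠ []) :
    queueWeight (popQueue v) + 1 = queueWeight v := by
  rcases v with _ | ⟨_ | _, v⟩
  · contradiction
  · simp +arith [queueWeight, popQueue]
  · simp +arith [queueWeight, popQueue]

theorem queueWeight_eq_zero {v : List DyckStep} : queueWeight v = 0 ↔ v = [] := by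
  rcases v with _ | ⟨_ | _, v⟩ <;> simp [queueWeight]

theorem queueRunsTotal_nil_zero : queueRunsTotal [] 0 = 1 := by
  simp [queueRunsTotal, wordsWithCounts, queueRuns]

theorem queueRunsTotal_nil_succ (k : ℕ) : queueRunsTotal [] (k + 1) = queueRunsTotal [.U] k := by
  simp [queueRunsTotal, sum_wordsWithCounts_succ_succ, queueRuns]

theorem queueRunsTotal_zero {v : List DyckStep} (hv : v ≠ []) :
    queueRunsTotal v 0 = queueRunsTotal (popQueue v) 0 := by
  rcases v with _ | ⟨_ | _, v⟩
  · contradiction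
  · simp [queueRunsTotal, popQueue, ← add_assoc, sum_wordsWithCounts_zero_succ, queueRuns]
  · rcases h : v.count .U with _ | j
    · simp [queueRunsTotal, popQueue, h, wordsWithCounts, queueRuns]
    · simp [queueRunsTotal, popQueue, h, sum_wordsWithCounts_zero_succ, queueRuns]

theorem queueRunsTotal_succ {v : List DyckStep} (hv : v ≠ []) (k : ℕ) :
    queueRunsTotal v (k + 1) =
      queueRunsTotal (v ++ [.U]) k + queueRunsTotal (popQueue v) (k + 1) := by
  have hcount (j : ℕ) : k + 1 + j = k + j + 1 := by ring
  rcases v with _ | ⟨_ | _, v⟩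
  · contradiction
  · simp [queueRunsTotal, popQueue, ← add_assoc, sum_wordsWithCounts_succ_succ, queueRuns, hcount]
  · simp [queueRunsTotal, popQueue, ← add_assoc, sum_wordsWithCounts_succ_succ, queueRuns, hcount,
      Finset.sum_add_distrib]

theorem queueRunsTotal_eq_ballotCount (v : List DyckStep) (k : ℕ) :
    queueRunsTotal v k = ballotCount 2 (queueWeight v) k := by
  generalize hp : queueWeight v = p
  have ne_nil_of_weight {v : List DyckStep} {p : ℕ} (h : queueWeight v = p + 1) : v ≠ [] := by
    rintro rfl; simp [queueWeight] at h
  fun_induction ballotCount 2 p k generalizing v with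
  | case1 => rw [queueWeight_eq_zero.1 hp, queueRunsTotal_nil_zero]
  | case2 p ih =>
    have hv := ne_nil_of_weight hp
    have hpop := queueWeight_popQueue hv
    rw [queueRunsTotal_zero hv, ih _ (by omega)]
  | case3 k ih => rw [queueWeight_eq_zero.1 hp, queueRunsTotal_nil_succ, ih _ rfl]
  | case4 p k ih_push ih_pop =>
    have hv := ne_nil_of_weight hp
    have hpop := queueWeight_popQueue hv
    rw [queueRunsTotal_succ hv, ih_push _ (by rw [queueWeight_append_U, hp]), ih_pop _ (by omega)]

/-- The number of ways to read the word `l` while writing the word `m`, where the admissible moves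
are those of `queueRuns` and the two words are treated as independent. -/
def readWriteRuns : List DyckStep → List DyckStep → ℕ
  | [], [] => 1
  | [], .D :: _ => 0
  | [], .U :: m => readWriteRuns [] m
  | .U :: _, [] => 0
  | .U :: l, .U :: m => readWriteRuns (.U :: l) m
  | .U :: l, .D :: m => readWriteRuns l m
  | .D :: l, [] => readWriteRuns l []
  | .D :: l, .U :: m => readWriteRuns (.D :: l) m + readWriteRuns l (.U :: m)
  | .D :: l, .D :: m => readWriteRuns l (.D :: m)
termination_by l m => l.length + m.length

/-- Every initial segment of `l` has at most `c` more letters `D` than letters `U`; for `c = 0` this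
is the Dyck condition. -/
def PrefixBounded (c : ℕ) (l : List DyckStep) : Prop :=
  ∀ k, (l.take k).count .D ≤ (l.take k).count .U + c

theorem prefixBounded_nil (c : ℕ) : PrefixBounded c [] := by simp [PrefixBounded]

theorem prefixBounded_cons_U {c : ℕ} {l : List DyckStep} :
    PrefixBounded c (.U :: l) ↔ PrefixBounded (c + 1) l := by
  simp [PrefixBounded, ← Nat.and_forall_add_one (p := fun k => List.count _ (List.take k _) ≤ _),
    add_assoc, add_comm]

theorem prefixBounded_succ_cons_D {c : ℕ} {l : List DyckStep} :
    PrefixBounded (c + 1) (.D :: l) ↔ PrefixBounded c l := by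
  simp [PrefixBounded, ← Nat.and_forall_add_one (p := fun k => List.count _ (List.take k _) ≤ _),
    ← add_assoc]

theorem not_prefixBounded_zero_cons_D {l : List DyckStep} : ¬ PrefixBounded 0 (.D :: l) :=
  fun h => by simpa using h 1

open Classical in
theorem queueRuns_eq_ite (v t : List DyckStep) :
    queueRuns v t =
      if PrefixBounded (v.count .D) (v ++ t) then readWriteRuns (v ++ t) t else 0 := by
  fun_induction queueRuns v t with
  | case1 => simp [prefixBounded_nil, readWriteRuns]
  | case2 t => simp [not_prefixBounded_zero_cons_D]
  | case3 t ih => simp [ih, readWriteRuns]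
  | case4 v => simp [readWriteRuns]
  | case5 v t ih => simpa [readWriteRuns] using ih
  | case6 v t ih => simp [ih, readWriteRuns, prefixBounded_cons_U]
  | case7 v ih => simp [ih, readWriteRuns, prefixBounded_succ_cons_D]
  | case8 v t ih_write ih_read =>
    rw [ih_write, ih_read]
    simp [readWriteRuns, prefixBounded_succ_cons_D, ite_add_ite]
  | case9 v t ih => simp [ih, readWriteRuns, prefixBounded_succ_cons_D]

open Classical in
theorem sum_dyckWord_eq_sum_wordsWithCounts {M : Type*} [AddCommMonoid M]
    (f : List DyckStep → M) (n : ℕ) :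
    ∑ D : {D : DyckWord // D.semilength = n}, f D.1.toList =
      ∑ l ∈ wordsWithCounts n n with PrefixBounded 0 l, f l := by
  refine Finset.sum_bij (fun D _ => D.1.toList) (fun D _ => ?_)
    (fun _ _ _ _ h => Subtype.ext (DyckWord.ext h)) (fun l hl => ?_) (fun _ _ => rfl)
  · rw [Finset.mem_filter, mem_wordsWithCounts]
    exact ⟨⟨D.2, D.1.count_U_eq_count_D ▸ D.2⟩, D.1.count_D_le_count_U⟩
  · obtain ⟨hcount, hprefix⟩ := Finset.mem_filter.1 hl
    obtain ⟨hU, hD⟩ := mem_wordsWithCounts.1 hcount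
    exact ⟨⟨⟨l, hU.trans hD.symm, hprefix⟩, hU⟩, Finset.mem_univ _, rfl⟩

theorem sum_readWriteRuns_dyckWord (n : ℕ) :
    ∑ D : {D : DyckWord // D.semilength = n}, readWriteRuns D.1.toList D.1.toList =
      ballotCount 2 0 n := by
  classical
  calc
    _ = ∑ l ∈ wordsWithCounts n n with PrefixBounded 0 l, readWriteRuns l l :=
      sum_dyckWord_eq_sum_wordsWithCounts (fun l => readWriteRuns l l) n
    _ = queueRunsTotal [] n := by
      rw [Finset.sum_filter]
      exact Finset.sum_congr rfl fun t _ => (queueRuns_eq_ite [] t).symm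
    _ = ballotCount 2 0 n := queueRunsTotal_eq_ballotCount [] n

/-- The number of letters other than `a` of the word `w` that are preceded by exactly `i` letters
`a`. For `0 < i < w.count a` this is the statistic `countBetween` in a form suited to recursion. -/
def gapLength (a : DyckStep) : List DyckStep → ℕ → ℕ
  | [], _ => 0
  | c :: w, 0 => if c = a then 0 else gapLength a w 0 + 1
  | c :: w, i + 1 => if c = a then gapLength a w i else gapLength a w (i + 1)

section GapLength

variable {a b c : DyckStep} (w : List DyckStep) (i : ℕ)

@[simp] theorem gapLength_nil : gapLength a [] i = 0 := by simp [gapLength]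

@[simp] theorem gapLength_cons_self_zero : gapLength a (a :: w) 0 = 0 := by simp [gapLength]

@[simp] theorem gapLength_cons_self_succ : gapLength a (a :: w) (i + 1) = gapLength a w i := by
  simp [gapLength]

@[simp] theorem gapLength_cons_of_ne_zero (h : c ≠ a) :
    gapLength a (c :: w) 0 = gapLength a w 0 + 1 := by simp [gapLength, h]

@[simp] theorem gapLength_cons_of_ne_succ (h : c ≠ a) :
    gapLength a (c :: w) (i + 1) = gapLength a w (i + 1) := by simp [gapLength, h]

theorem gapLength_append_self_count : gapLength a (w ++ [a]) (w.count a + 1) = 0 := by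
  induction w with
  | nil => simp
  | cons c w ih =>
    by_cases h : c = a
    · subst h; simpa using ih
    · simpa [h] using ih

theorem card_filter_eq_gapLength (hab : b ≠ a) :
    ((Finset.range w.length).filter fun j =>
      w[j]? = some b ∧ (w.take j).count a = i).card = gapLength a w i := by
  induction w generalizing i with
  | nil => simp
  | cons c w ih =>
    rw [List.length_cons, Finset.card_filter, Finset.sum_range_succ']
    simp only [Finset.card_filter] at ih
    by_cases h : c = a
    · subst h
      rcases i with _ | i <;> simp [hab.symm, ih]
    · obtain rfl : c = b := by cases a <;> cases b <;> cases c <;> simp_all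
      rcases i with _ | i <;> simp [h, ih]

end GapLength

theorem exists_lt_isNthOccurrence (w : List DyckStep) (a : DyckStep) (i j : ℕ) :
    (∃ p < j, IsNthOccurrence w a (i + 1) p) ↔ i < (w.take j).count a := by
  induction j with
  | zero => simp
  | succ j ih =>
    rw [Nat.exists_lt_succ_right, ih, IsNthOccurrence, List.take_add_one, List.count_append]
    rcases w[j]? with _ | c
    · simp
    · by_cases hc : c = a
      · subst hc
        simp only [Option.toList_some, List.count_singleton_self, true_and]
        omega
      · simp [hc]

theorem exists_gt_isNthOccurrence {w : List DyckStep} {a : DyckStep} {i j : ℕ}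
    (hj : w[j]? ≠ some a) (hi : i < w.count a) :
    (∃ q < w.length, j < q ∧ IsNthOccurrence w a (i + 1) q) ↔ (w.take j).count a ≤ i := by
  constructor
  · rintro ⟨q, -, hjq, -, hq⟩
    have := ((List.take_prefix_take_left hjq.le : w.take j <+: w.take q).sublist).count_le a
    omega
  · intro hcount
    obtain ⟨q, hq, hocc⟩ := (exists_lt_isNthOccurrence w a i w.length).2 (by simpa using hi)
    have hqj : q ≠ j := by rintro rfl; exact hj hocc.1
    have hjq : ¬ q < j := fun h =>
      hcount.not_gt ((exists_lt_isNthOccurrence w a i j).1 ⟨q, h, hocc⟩)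
    exact ⟨q, hq, by omega, hocc⟩

theorem countBetween_eq_gapLength {a b : DyckStep} (hab : b ≠ a) {w : List DyckStep} {i : ℕ}
    (hi : 1 ≤ i) (hiw : i < w.count a) : countBetween w a b i = gapLength a w i := by
  obtain ⟨i, rfl⟩ := Nat.exists_eq_add_of_le' hi
  rw [← card_filter_eq_gapLength w _ hab, countBetween]
  refine congrArg _ (Finset.filter_congr fun j _ => and_congr_right fun hb => ?_)
  rw [exists_lt_isNthOccurrence, exists_gt_isNthOccurrence (by simpa [hb] using hab) hiw]
  omega

theorem readWriteRuns_eq_prod_choose (l m : List DyckStep) (h : l.count .U = m.count .D) :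
    readWriteRuns l m = ∏ i ∈ Finset.range (l.count .U + 1),
      (gapLength .U l i + gapLength .D m i).choose (gapLength .U l i) := by
  fun_induction readWriteRuns l m with
  | case1 => simp
  | case2 => simp at h
  | case3 m ih =>
    rw [ih (by simpa using h)]
    simp
  | case4 => simp at h
  | case5 l m ih =>
    rw [ih (by simpa using h), Finset.prod_range_succ', Finset.prod_range_succ' _ (List.count _ _)]
    simp
  | case6 l m ih =>
    rw [ih (by simpa using h), List.count_cons_self, Finset.prod_range_succ' _ (_ + 1)]
    simp
  | case7 l ih =>
    have hl : l.count .U = 0 := by simpa using h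
    rw [ih (by simpa using hl)]
    simp [hl]
  | case8 l m ih_write ih_read =>
    -- Only the factor at `0` differs among the three products, and there it is Pascal's rule.
    rw [ih_write (by simpa using h), ih_read (by simpa using h)]
    simp only [Finset.prod_range_succ', ne_eq, reduceCtorEq, not_false_eq_true,
      gapLength_cons_of_ne_succ, gapLength_cons_of_ne_zero, List.count_cons_of_ne]
    rw [← mul_add]
    congr 1
    generalize gapLength .U l 0 = r, gapLength .D m 0 = s
    rw [← add_assoc r, add_right_comm r s, ← add_assoc (r + 1), Nat.choose_succ_succ', add_comm]
  | case9 l m ih =>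
    rw [ih (by simpa using h)]
    simp [Finset.prod_range_succ']

theorem gapLength_U_dyckWord_zero (D : DyckWord) : gapLength .U D.toList 0 = 0 := by
  rcases hD : D.toList with _ | ⟨c, l⟩
  · exact gapLength_nil 0
  · obtain rfl : c = .U := by simpa [hD] using D.head_eq_U (by simp [hD])
    exact gapLength_cons_self_zero l

theorem gapLength_D_dyckWord_semilength (D : DyckWord) :
    gapLength .D D.toList D.semilength = 0 := by
  rw [D.semilength_eq_count_D]
  rcases D.toList.eq_nil_or_concat with hD | ⟨l, c, hD⟩
  · rw [hD, gapLength_nil]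
  · obtain rfl : c = .D := by simpa [hD] using D.getLast_eq_D (by simp [hD])
    simpa [hD] using gapLength_append_self_count l

theorem prod_choose_rStat_eq_readWriteRuns (D : DyckWord) :
    ∏ i ∈ Finset.Icc 1 (D.semilength - 1), (D.rStat i + D.sStat i).choose (D.rStat i) =
      readWriteRuns D.toList D.toList := by
  rw [readWriteRuns_eq_prod_choose _ _ D.count_U_eq_count_D, ← DyckWord.semilength]
  refine Finset.prod_subset_one_on_sdiff (fun i hi => ?_) (fun i hi => ?_) (fun i hi => ?_)
  · rw [Finset.mem_Icc] at hi
    rw [Finset.mem_range]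
    omega
  · have hends : i = 0 ∨ i = D.semilength := by
      rw [Finset.mem_sdiff, Finset.mem_range, Finset.mem_Icc] at hi
      omega
    rcases hends with rfl | rfl
    · rw [gapLength_U_dyckWord_zero, Nat.choose_zero_right]
    · rw [gapLength_D_dyckWord_semilength, add_zero, Nat.choose_self]
  · obtain ⟨hi_pos, hi_lt⟩ : 1 ≤ i ∧ i < D.semilength := by
      rw [Finset.mem_Icc] at hi
      omega
    rw [DyckWord.rStat, DyckWord.sStat, countBetween_eq_gapLength (by simp) hi_pos hi_lt,
      countBetween_eq_gapLength (by simp) hi_pos (D.semilength_eq_count_D ▸ hi_lt)]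

theorem mainTheorem7 (n : ℕ) (hn : 1 ≤ n) :
    ((∑ D : {D : DyckWord // D.semilength = n},
        ∏ i ∈ Finset.Icc 1 (n - 1),
          (D.1.rStat i + D.1.sStat i).choose (D.1.rStat i) : ℕ) : ℚ) =
      1 / (2 * (n : ℚ) + 1) * ((3 * n).choose n : ℚ) := by
  have hruns (D : {D : DyckWord // D.semilength = n}) :
      ∏ i ∈ Finset.Icc 1 (n - 1), (D.1.rStat i + D.1.sStat i).choose (D.1.rStat i) =
        readWriteRuns D.1.toList D.1.toList := by
    rw [← prod_choose_rStat_eq_readWriteRuns, D.2]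
  have hballot : (2 * n + 1) * ballotCount 2 0 n = (3 * n).choose n :=
    mul_add_one_mul_ballotCount_zero 2 n
  simp only [hruns, sum_readWriteRuns_dyckWord, ← hballot]
  push_cast
  field_simp
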